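/- Let $\mathcal H$ be a real Hilbert space and let $n\ge 3$. Let $A_1,\dots,A_n\colon\mathcal H\rightrightarrows\mathcal H$ be maximally monotone set-valued operators, and let $B_1,\dots,B_{n-2}\colon\mathcal H\to\mathcal H$ be monotone and $L$-Lipschitz continuous for some $L>0$. Suppose that $$\operatorname{zer}\Bigl(\sum_{i=1}^nA_i+\sum_{i=1}^{n-2}B_i\Bigr):=\Bigl\{x\in\mathcal H:\ 0\in\sum_{i=1}^nA_i(x)+\sum_{i=1}^{n-2}B_i(x)\Bigr\}\neq\varnothing .$$ Let $\lambda\in\bigl(0,\frac{1}{2L}\bigr)$ and $\gamma\in(0,1-2\lambda L)$, and let $J_{\lambda A_i}=(\mathrm{Id}+\lambda A_i)^{-1}$ denote the resolvent, which is a single-valued map defined on all of $\mathcal H$. For $\mathbf z=(z_1,\dots,z_{n-1})\in\mathcal H^{n-1}$ let $\mathbf x(\mathbf z)=(x_1,\dots,x_n)\in\mathcal H^n$ be given by $$\begin{aligned} x_1&=J_{\lambda A_1}(z_1),\\ x_2&=J_{\lambda A_2}\bigl(z_2+x_1-z_1-\lambda B_1(x_1)\bigr),\\ x_i&=J_{\lambda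 A_i}\bigl(z_i+x_{i-1}-z_{i-1}-\lambda B_{i-1}(x_{i-1})-\lambda(B_{i-2}(x_{i-1})-B_{i-2}(x_{i-2}))\bigr)\qquad(3\le i\le n-1),\\ x_n&=J_{\lambda A_n}\bigl(x_1+x_{n-1}-z_{n-1}-\lambda(B_{n-2}(x_{n-1})-B_{n-2}(x_{n-2}))\bigr), \end{aligned}$$ and define $\widetilde T\colon\mathcal H^{n-1}\to\mathcal H^{n-1}$ by $$\widetilde T(\mathbf z)=\mathbf z+\gamma\,(x_2-x_1,\;x_3-x_2,\;\dots,\;x_n-x_{n-1}),\qquad (x_1,\dots,x_n)=\mathbf x(\mathbf z).$$ Given $\mathbf z^0\in\mathcal H^{n-1}$, let $\mathbf x^k=\mathbf x(\mathbf z^k)$ and $\mathbf z^{k+1}=\mathbf z^k+\gamma\,(x_2^k-x_1^k,\dots,x_n^k-x_{n-1}^k)$ for all $k\ge 0$. Then: (a) the sequence $(\mathbf z^k)$ converges weakly to a point $\mathbf z\in\operatorname{Fix}\widetilde T$, that is, a point with $\widetilde T(\mathbf z)=\mathbf z$; (b) the sequence $(\mathbf x^k)$ converges weakly to a point $(x,\dots,x)\in\mathcal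 H^n$ with $x\in\operatorname{zer}\bigl(\sum_{i=1}^nA_i+\sum_{i=1}^{n-2}B_i\bigr)$. -/

import Mathlib

open scoped NNReal Topology Pointwise

noncomputable section

namespace DFRB

/-- Set-valued operators on `H`. Sums and scalar multiples are taken pointwise, in the sense of
Minkowski sums and dilations of sets. -/
abbrev SetOp (H : Type*) := H → Set H

/-- A single-valued mapping, regarded as a set-valued operator. -/
def SetOp.ofMap {H : Type*} (B : H → H) : SetOp H := fun x => {B x}

/-- The graph of a set-valued operator. -/
def SetOp.graph {H : Type*} (A : SetOp H) : Set (H × H) := {p | p.2 ∈ A p.1}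

/-- The inverse operator: `x ∈ A⁻¹ u` if and only if `u ∈ A x`. -/
def SetOp.inverse {H : Type*} (A : SetOp H) : SetOp H := fun u => {x | u ∈ A x}

/-- The set of zeros of a set-valued operator. -/
def SetOp.zer {H : Type*} [Zero H] (A : SetOp H) : Set H := {x | 0 ∈ A x}

section Hilbert

variable {H : Type*} [NormedAddCommGroup H] [InnerProductSpace ℝ H]

/-- Monotone set-valued operators. -/
def SetOp.IsMonotone (A : SetOp H) : Prop :=
  ∀ p ∈ A.graph, ∀ q ∈ A.graph, 0 ≤ inner ℝ (p.1 - q.1) (p.2 - q.2)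

/-- Maximally monotone set-valued operators. -/
def SetOp.IsMaximallyMonotone (A : SetOp H) : Prop :=
  A.IsMonotone ∧ ¬ ∃ C : SetOp H, C.IsMonotone ∧ A.graph ⊂ C.graph

/-- The (set-valued) resolvent `(Id + c A)⁻¹`. -/
def SetOp.resolvent (c : ℝ) (A : SetOp H) : SetOp H :=
  SetOp.inverse (SetOp.ofMap id + c • A)

open Classical in
/-- The resolvent as a mapping: the element of `SetOp.resolvent c A u`. For `c > 0` and `A`
maximally monotone the set-valued resolvent is a singleton at every `u`, so that the default
value `0` is not used. -/
def J (c : ℝ) (A : SetOp H) (u : H) : H :=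
  if h : (SetOp.resolvent c A u).Nonempty then h.some else 0

/-- Weak convergence of a sequence (convergence in Mathlib's weak topology). -/
def WeaklyConvergesTo {E : Type*} [NormedAddCommGroup E] [NormedSpace ℝ E]
    (u : ℕ → E) (a : E) : Prop :=
  Filter.Tendsto (fun k => toWeakSpace ℝ E (u k)) Filter.atTop (𝓝 (toWeakSpace ℝ E a))

/-- The Hilbert space `H ^ k`. -/
abbrev Pow (H : Type*) (k : ℕ) := PiLp 2 (fun _ : Fin k => H)

variable {n : ℕ}

/-- The components of the vector `𝐱 ∈ H ^ n` that is computed from `𝐳 ∈ H ^ (n - 1)`. Indices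
start at `0` here: `A i`, `B i`, `z i`, and component `i` stand for `A_{i+1}`, `B_{i+1}`,
`z_{i+1}`, and `x_{i+1}`. -/
def xComp (hn : 3 ≤ n) (A : Fin n → SetOp H) (B : Fin (n - 2) → H → H) (lam : ℝ)
    (z : Pow H (n - 1)) : (i : ℕ) → i < n → H
  | 0, h => J lam (A ⟨0, h⟩) (z ⟨0, by omega⟩)
  | 1, h =>
      let x₀ := xComp hn A B lam z 0 (by omega)
      J lam (A ⟨1, h⟩)
        (z ⟨1, by omega⟩ + x₀ - z ⟨0, by omega⟩ - lam • B ⟨0, by omega⟩ x₀)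
  | i + 2, h =>
      let x₀ := xComp hn A B lam z 0 (by omega)
      let p := xComp hn A B lam z (i + 1) (by omega)
      let q := xComp hn A B lam z i (by omega)
      if h' : i + 2 < n - 1 then
        J lam (A ⟨i + 2, h⟩)
          (z ⟨i + 2, h'⟩ + p - z ⟨i + 1, by omega⟩ - lam • B ⟨i + 1, by omega⟩ p
            - lam • (B ⟨i, by omega⟩ p - B ⟨i, by omega⟩ q))
      else
        J lam (A ⟨i + 2, h⟩)
          (x₀ + p - z ⟨i + 1, by omega⟩ - lam • (B ⟨i, by omega⟩ p - B ⟨i, by omega⟩ q))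
termination_by i => i

/-- The vector `𝐱 = (x₁, …, xₙ) ∈ H ^ n` that is computed from `𝐳 ∈ H ^ (n - 1)`. -/
def xVec (hn : 3 ≤ n) (A : Fin n → SetOp H) (B : Fin (n - 2) → H → H) (lam : ℝ)
    (z : Pow H (n - 1)) : Pow H n :=
  WithLp.toLp 2 (fun i => xComp hn A B lam z i i.2)

/-- The vector `(x₂ - x₁, …, xₙ - xₙ₋₁) ∈ H ^ (n - 1)`. -/
def diffVec (x : Pow H n) : Pow H (n - 1) :=
  WithLp.toLp 2 (fun i => x ⟨i + 1, by omega⟩ - x ⟨i, by omega⟩)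

/-- The fixed point operator `T̃ : H ^ (n - 1) → H ^ (n - 1)`. -/
def TTilde (hn : 3 ≤ n) (A : Fin n → SetOp H) (B : Fin (n - 2) → H → H) (lam γ : ℝ)
    (z : Pow H (n - 1)) : Pow H (n - 1) :=
  z + γ • diffVec (xVec hn A B lam z)

/-! The vector `xVec` satisfies the four displayed equations of the method. -/

theorem xVec_first (hn : 3 ≤ n) (A : Fin n → SetOp H) (B : Fin (n - 2) → H → H) (lam : ℝ)
    (z : Pow H (n - 1)) :
    xVec hn A B lam z ⟨0, by omega⟩ = J lam (A ⟨0, by omega⟩) (z ⟨0, by omega⟩) := by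
  simp only [xVec]
  rw [xComp]

theorem xVec_second (hn : 3 ≤ n) (A : Fin n → SetOp H) (B : Fin (n - 2) → H → H) (lam : ℝ)
    (z : Pow H (n - 1)) (x : Pow H n) (hx : x = xVec hn A B lam z) :
    x ⟨1, by omega⟩ = J lam (A ⟨1, by omega⟩)
      (z ⟨1, by omega⟩ + x ⟨0, by omega⟩ - z ⟨0, by omega⟩
        - lam • B ⟨0, by omega⟩ (x ⟨0, by omega⟩)) := by
  subst hx
  change xComp hn A B lam z 1 _ = _
  rw [xComp]
  rfl

theorem xVec_middle (hn : 3 ≤ n) (A : Fin n → SetOp H) (B : Fin (n - 2) → H → H) (lam : ℝ)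
    (z : Pow H (n - 1)) (x : Pow H n) (hx : x = xVec hn A B lam z) (i : ℕ) (hi : i + 3 < n) :
    x ⟨i + 2, by omega⟩ = J lam (A ⟨i + 2, by omega⟩)
      (z ⟨i + 2, by omega⟩ + x ⟨i + 1, by omega⟩ - z ⟨i + 1, by omega⟩
        - lam • B ⟨i + 1, by omega⟩ (x ⟨i + 1, by omega⟩)
        - lam • (B ⟨i, by omega⟩ (x ⟨i + 1, by omega⟩)
          - B ⟨i, by omega⟩ (x ⟨i, by omega⟩))) := by
  subst hx
  simp only [xVec]
  rw [xComp]
  simp only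
  rw [dif_pos (by omega)]

theorem xVec_last (hn : 3 ≤ n) (A : Fin n → SetOp H) (B : Fin (n - 2) → H → H) (lam : ℝ)
    (z : Pow H (n - 1)) (x : Pow H n) (hx : x = xVec hn A B lam z) :
    x ⟨n - 1, by omega⟩ = J lam (A ⟨n - 1, by omega⟩)
      (x ⟨0, by omega⟩ + x ⟨n - 2, by omega⟩ - z ⟨n - 2, by omega⟩
        - lam • (B ⟨n - 3, by omega⟩ (x ⟨n - 2, by omega⟩)
          - B ⟨n - 3, by omega⟩ (x ⟨n - 3, by omega⟩))) := by
  subst hx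
  obtain ⟨m, rfl⟩ : ∃ m, n = m + 3 := ⟨n - 3, by omega⟩
  change xComp hn A B lam z (m + 2) _ = _
  rw [xComp]
  simp only
  rw [dif_neg (by omega)]
  rfl

end Hilbert

end DFRB

end

/-! Put `N = n - 1` and `l = λL`, use indices from `0`, let `M i = λ A i`, and let `b` be the scaled
forward operators shifted by one, so that `b 0 = b N = 0`. With `z N = 0` and `f i = b i (x i) - b i
(x (i - 1))`, one iteration says exactly that vectors `c i` (`stepVec`), affine in `z`, `x` and `f`,
lie in `(M i + b i) (x i)`. If `x` is constantly `p`, the `c i` telescope to the sum `z N = 0`, so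
`p` is a zero; conversely, every zero arises from some such `z`.

Let `z'` be such a point for `p`, and let `d i = x (i + 1) - x i`. Pairing the inclusions at `z`
with those at `z'` and summing by parts (`sum_inner_stepVec`) leaves only terms in the differences
of `x`. Lipschitz continuity gives `‖f (i + 1)‖ ≤ l ‖d i‖`, hence `2⟪d, z - z'⟫ ≤ -(1 - 2l)‖d‖²`,
and therefore `‖z + γ d - z'‖² ≤ ‖z - z'‖² - γ(1 - 2l - γ)‖d‖²`. Thus the iterates are Fejér
monotone and `d` tends to `0` along them.

Weak cluster points again solve the inclusions with constant `x` (demiclosedness,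
`IsAdmissible.isStep_of_weakTendsto`), so Opial's lemma gives weak convergence of `z`. The first
resolvent determines `p` from the limit of `z`, which fixes the weak limit of every component of
`x`. That resolvents are everywhere defined is Minty's theorem, proved by minimizing the Fitzpatrick
function plus half the squared norm. -/

namespace DFRB

/-! ### Minty's theorem via the Fitzpatrick function -/

section Minty

variable {H : Type*} [NormedAddCommGroup H] [InnerProductSpace ℝ H]

theorem SetOp.IsMaximallyMonotone.mem_of_forall {A : SetOp H} (hA : A.IsMaximallyMonotone)
    {x u : H} (h : ∀ y, ∀ v ∈ A y, 0 ≤ inner ℝ (x - y) (u - v)) : u ∈ A x := by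
  by_contra hxu
  refine hA.2 ⟨fun y => {v | v ∈ A y ∨ (y = x ∧ v = u)}, ?_, ?_⟩
  · rintro ⟨y, v⟩ hp ⟨y', v'⟩ hq
    rcases hp with hp | ⟨rfl, rfl⟩ <;> rcases hq with hq | ⟨h1, h2⟩
    · exact hA.1 _ hp _ hq
    · obtain rfl : y' = x := h1
      obtain rfl : v' = u := h2
      have := h y v hp
      rwa [← neg_sub y y', ← neg_sub v v', inner_neg_neg] at this
    · exact h y' v' hq
    · obtain rfl : y' = _ := h1
      obtain rfl : v' = _ := h2
      simp
  · refine ⟨fun p hp => Or.inl hp, fun hsub => hxu ?_⟩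
    exact @hsub (x, u) (Or.inr ⟨rfl, rfl⟩)

theorem SetOp.IsMaximallyMonotone.exists_mem {A : SetOp H} (hA : A.IsMaximallyMonotone) :
    ∃ y, ∃ v, v ∈ A y := by
  by_contra! h
  exact h 0 0 (hA.mem_of_forall fun y v hv => (h y v hv).elim)

/-- The values bounding the Fitzpatrick function of `A` plus half the squared norm at `w`. -/
def fitzpatrickBound (A : SetOp H) (w : H × H) (s : ℝ) : Prop :=
  ∀ y, ∀ v ∈ A y, inner ℝ w.1 v + inner ℝ y w.2 - inner ℝ y v
    + (‖w.1‖ ^ 2 + ‖w.2‖ ^ 2) / 2 ≤ s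

/-- Otherwise `w` would be monotonically related to the whole graph, hence in it by maximality, and
the bound tested at `w` itself would fail. -/
theorem fitzpatrickBound.inner_le {A : SetOp H} (hA : A.IsMaximallyMonotone) {w : H × H} {s : ℝ}
    (h : fitzpatrickBound A w s) : inner ℝ w.1 w.2 + (‖w.1‖ ^ 2 + ‖w.2‖ ^ 2) / 2 ≤ s := by
  by_contra! hlt
  have key : ∀ y, ∀ v ∈ A y, 0 ≤ inner ℝ (w.1 - y) (w.2 - v) := by
    intro y v hv
    have := h y v hv
    simp only [inner_sub_left, inner_sub_right]
    linarith
  have := h w.1 w.2 (hA.mem_of_forall key)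
  linarith

theorem fitzpatrickBound.nonneg {A : SetOp H} (hA : A.IsMaximallyMonotone) {w : H × H} {s : ℝ}
    (h : fitzpatrickBound A w s) : 0 ≤ s := by
  have h1 := h.inner_le hA
  have h2 := norm_add_sq_real w.1 w.2
  nlinarith [sq_nonneg ‖w.1 + w.2‖]

theorem fitzpatrickBound_self {A : SetOp H} (hA : A.IsMonotone) {y v : H} (hv : v ∈ A y) :
    fitzpatrickBound A (y, v) (inner ℝ y v + (‖y‖ ^ 2 + ‖v‖ ^ 2) / 2) := by
  intro y' v' hv'
  have := hA (y, v) hv (y', v') hv'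
  simp only [inner_sub_left, inner_sub_right] at this
  simp only
  linarith

theorem norm_sq_combo (x y : H) (t : ℝ) :
    ‖x + t • (y - x)‖ ^ 2 = (1 - t) * ‖x‖ ^ 2 + t * ‖y‖ ^ 2 - t * (1 - t) * ‖y - x‖ ^ 2 := by
  simp only [← real_inner_self_eq_norm_sq, inner_add_left, inner_add_right, inner_sub_left,
    inner_sub_right, inner_smul_left, inner_smul_right, real_inner_comm x y]
  simp
  ring

/-- Strong convexity. -/
theorem fitzpatrickBound.combo {A : SetOp H} {w w' : H × H} {s s' t : ℝ}
    (h : fitzpatrickBound A w s) (h' : fitzpatrickBound A w' s') (ht : 0 ≤ t) (ht' : t ≤ 1) :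
    fitzpatrickBound A (w.1 + t • (w'.1 - w.1), w.2 + t • (w'.2 - w.2))
      ((1 - t) * s + t * s' - t * (1 - t) * ((‖w'.1 - w.1‖ ^ 2 + ‖w'.2 - w.2‖ ^ 2) / 2)) := by
  intro y v hv
  have h1 := mul_le_mul_of_nonneg_left (h y v hv) (sub_nonneg.2 ht')
  have h2 := mul_le_mul_of_nonneg_left (h' y v hv) ht
  simp only [norm_sq_combo, inner_add_left, inner_add_right, inner_smul_left, inner_smul_right,
    inner_sub_left, inner_sub_right]
  simp only [conj_trivial]
  linarith

theorem isClosed_fitzpatrickBound (A : SetOp H) (s : ℝ) :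
    IsClosed {w | fitzpatrickBound A w s} := by
  simp only [fitzpatrickBound, Set.ofPred_forall]
  refine isClosed_iInter fun y => isClosed_iInter fun v => isClosed_iInter fun _ => ?_
  exact isClosed_le (by fun_prop) continuous_const

theorem exists_minimal_fitzpatrickBound [CompleteSpace H] {A : SetOp H}
    (hA : A.IsMaximallyMonotone) :
    ∃ w s, fitzpatrickBound A w s ∧ ∀ w' s', fitzpatrickBound A w' s' → s ≤ s' := by
  obtain ⟨y₀, v₀, hv₀⟩ := hA.exists_mem
  set S : Set ℝ := {s | ∃ w, fitzpatrickBound A w s}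
  have hbdd : BddBelow S := ⟨0, by rintro s ⟨w, hw⟩; exact hw.nonneg hA⟩
  have hne : S.Nonempty := ⟨_, _, fitzpatrickBound_self hA.1 hv₀⟩
  have hle : ∀ w' s', fitzpatrickBound A w' s' → sInf S ≤ s' := fun w' s' h =>
    csInf_le hbdd ⟨w', h⟩
  have hex : ∀ k : ℕ, ∃ w, fitzpatrickBound A w (sInf S + (1 / 2 : ℝ) ^ k) := by
    intro k
    obtain ⟨s, ⟨w, hw⟩, hs⟩ := exists_lt_of_csInf_lt hne
      (lt_add_of_pos_right (sInf S) (by positivity : (0 : ℝ) < (1 / 2) ^ k))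
    exact ⟨w, fun y v hv => (hw y v hv).trans hs.le⟩
  choose w hw using hex
  have hmono : ∀ {k l : ℕ}, k ≤ l → fitzpatrickBound A (w l) (sInf S + (1 / 2 : ℝ) ^ k) := by
    intro k l hkl y v hv
    have : (1 / 2 : ℝ) ^ l ≤ (1 / 2) ^ k := pow_le_pow_of_le_one (by norm_num) (by norm_num) hkl
    linarith [hw l y v hv]
  have hclose : ∀ k l, k ≤ l → dist (w k) (w l) ^ 2 ≤ 8 * (1 / 2 : ℝ) ^ k := by
    intro k l hkl
    -- At the midpoint, strong convexity gains one eighth of the sum of the two squared component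
    -- distances, while only `(1 / 2) ^ k` is available above the infimum.
    have h1 := hle _ _ ((hw k).combo (hmono hkl) (t := 1 / 2) (by norm_num) (by norm_num))
    have h2 : ‖(w l).1 - (w k).1‖ ^ 2 + ‖(w l).2 - (w k).2‖ ^ 2 ≤ 8 * (1 / 2 : ℝ) ^ k := by
      linarith
    rw [dist_comm, Prod.dist_eq, dist_eq_norm, dist_eq_norm]
    rcases max_choice ‖(w l).1 - (w k).1‖ ‖(w l).2 - (w k).2‖ with h | h <;> rw [h] <;>
      nlinarith [sq_nonneg ‖(w l).1 - (w k).1‖, sq_nonneg ‖(w l).2 - (w k).2‖]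
  have hlim0 : Filter.Tendsto (fun k : ℕ => (1 / 2 : ℝ) ^ k) Filter.atTop (𝓝 0) :=
    tendsto_pow_atTop_nhds_zero_of_lt_one (by norm_num) (by norm_num)
  have hcauchy : CauchySeq w := by
    refine cauchySeq_of_le_tendsto_0' (fun k => Real.sqrt (8 * (1 / 2 : ℝ) ^ k)) ?_ ?_
    · intro k l hkl
      exact Real.le_sqrt_of_sq_le (hclose k l hkl)
    · have := (hlim0.const_mul 8).sqrt
      simpa using this
  obtain ⟨a, ha⟩ := cauchySeq_tendsto_of_complete hcauchy
  refine ⟨a, sInf S, ?_, hle⟩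
  have hak : ∀ k : ℕ, fitzpatrickBound A a (sInf S + (1 / 2 : ℝ) ^ k) := fun k =>
    (isClosed_fitzpatrickBound A _).mem_of_tendsto ha
      (Filter.eventually_atTop.2 ⟨k, fun l hl => hmono hl⟩)
  intro y v hv
  have := hlim0.const_add (sInf S)
  rw [add_zero] at this
  exact ge_of_tendsto' this fun k => hak k y v hv

/-- Minty's theorem at the origin. -/
theorem SetOp.IsMaximallyMonotone.exists_neg_mem [CompleteSpace H] {A : SetOp H}
    (hA : A.IsMaximallyMonotone) : ∃ x, -x ∈ A x := by
  obtain ⟨w, s, hw, hmin⟩ := exists_minimal_fitzpatrickBound hA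
  have hgrowth : ∀ w' s', fitzpatrickBound A w' s' →
      s + (‖w'.1 - w.1‖ ^ 2 + ‖w'.2 - w.2‖ ^ 2) / 2 ≤ s' := by
    intro w' s' h'
    set q := (‖w'.1 - w.1‖ ^ 2 + ‖w'.2 - w.2‖ ^ 2) / 2
    -- Minimality along the segment from `w` to `w'` is divided by `t`; then `t → 0` recovers the
    -- full quadratic term `q`.
    have hq : ∀ t : ℝ, t ∈ Set.Ioc (0 : ℝ) 1 → s + (1 - t) * q ≤ s' := by
      rintro t ⟨h0, h1⟩
      have : s ≤ (1 - t) * s + t * s' - t * (1 - t) * q := hmin _ _ (hw.combo h' h0.le h1)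
      have h2 : 0 ≤ t * (s' - s - (1 - t) * q) := by linarith
      have := nonneg_of_mul_nonneg_right h2 h0
      linarith
    have hlim : Filter.Tendsto (fun t : ℝ => s + (1 - t) * q) (𝓝[>] 0) (𝓝 (s + (1 - 0) * q)) :=
      (Continuous.tendsto (by fun_prop) 0).mono_left nhdsWithin_le_nhds
    have := le_of_tendsto hlim (Filter.mem_of_superset (Ioc_mem_nhdsGT one_pos) hq)
    linarith
  have hbase := hw.inner_le hA
  have hkey : ∀ y, ∀ v ∈ A y, ‖w.1 + w.2‖ ^ 2 ≤ inner ℝ (y + w.2) (v + w.1) := by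
    intro y v hv
    have h1 := hgrowth _ _ (fitzpatrickBound_self hA.1 hv)
    simp only [norm_sub_sq_real] at h1
    rw [norm_add_sq_real]
    simp only [inner_add_left, inner_add_right]
    rw [real_inner_comm w.1 w.2, real_inner_comm v w.2]
    linarith
  -- By `hkey` the swapped and negated minimizer is monotonically related to the graph. Inserting it
  -- back into `hkey` annihilates the right side and forces `w.1 + w.2 = 0`.
  have hmem : -w.1 ∈ A (-w.2) := by
    refine hA.mem_of_forall fun y v hv => ?_
    have := (sq_nonneg _).trans (hkey y v hv)
    rw [← inner_neg_neg]
    simpa [add_comm] using this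
  have h0 := hkey _ _ hmem
  have : w.1 + w.2 = 0 := by
    simp only [neg_add_cancel, inner_zero_right] at h0
    exact norm_eq_zero.1 (pow_eq_zero_iff (two_ne_zero) |>.1 (le_antisymm h0 (sq_nonneg _)))
  refine ⟨w.1, ?_⟩
  rwa [← eq_neg_of_add_eq_zero_left this] at hmem

theorem SetOp.mem_smul_iff {A : SetOp H} {c : ℝ} (hc : c ≠ 0) {x v : H} :
    v ∈ (c • A) x ↔ c⁻¹ • v ∈ A x :=
  Set.mem_smul_set_iff_inv_smul_mem₀ hc _ _

theorem SetOp.IsMonotone.smul {A : SetOp H} (hA : A.IsMonotone) {c : ℝ} (hc : 0 ≤ c) :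
    (c • A).IsMonotone := by
  rintro ⟨y, v⟩ hp ⟨y', v'⟩ hq
  obtain ⟨a, ha, rfl⟩ : ∃ a ∈ A y, c • a = v := hp
  obtain ⟨a', ha', rfl⟩ : ∃ a ∈ A y', c • a = v' := hq
  have := hA (y, a) ha (y', a') ha'
  simp only [← smul_sub, inner_smul_right] at this ⊢
  positivity

/-- Minty's theorem. -/
theorem SetOp.IsMaximallyMonotone.exists_sub_mem_smul [CompleteSpace H] {A : SetOp H}
    (hA : A.IsMaximallyMonotone) {c : ℝ} (hc : 0 < c) (u : H) : ∃ x, u - x ∈ (c • A) x := by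
  -- Scaling and translation reduce the claim to the case of the origin; maximality of `D` is tested
  -- against the graph of `A` by undoing both.
  set D : SetOp H := fun y => {v | v + u ∈ (c • A) y}
  have hDmax : D.IsMaximallyMonotone := by
    constructor
    · rintro ⟨y, v⟩ hp ⟨y', v'⟩ hq
      simpa using hA.1.smul hc.le (y, v + u) hp (y', v' + u) hq
    · rintro ⟨C, hC, hsub, hnot⟩
      refine hnot ?_
      rintro ⟨y, v⟩ hp
      change v + u ∈ (c • A) y
      rw [SetOp.mem_smul_iff hc.ne']
      refine hA.mem_of_forall fun y' v' hv' => ?_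
      have hmem : c • v' - u ∈ C y' := by
        refine @hsub (y', c • v' - u) ?_
        change c • v' - u + u ∈ (c • A) y'
        rw [sub_add_cancel]
        exact Set.smul_mem_smul_set hv'
      have h1 := hC _ hp (y', c • v' - u) hmem
      have h2 : c⁻¹ • (v + u) - v' = c⁻¹ • (v - (c • v' - u)) := by
        rw [sub_sub_eq_add_sub, smul_sub, smul_smul, inv_mul_cancel₀ hc.ne', one_smul]
      rw [h2, inner_smul_right]
      exact mul_nonneg (inv_nonneg.2 hc.le) h1
  obtain ⟨x, hx⟩ := hDmax.exists_neg_mem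
  refine ⟨x, ?_⟩
  have : -x + u ∈ (c • A) x := hx
  rwa [neg_add_eq_sub] at this

theorem SetOp.IsMaximallyMonotone.sub_J_mem [CompleteSpace H] {A : SetOp H}
    (hA : A.IsMaximallyMonotone) {c : ℝ} (hc : 0 < c) (u : H) : u - J c A u ∈ (c • A) (J c A u) := by
  have hne : (SetOp.resolvent c A u).Nonempty := by
    obtain ⟨x, hx⟩ := hA.exists_sub_mem_smul hc u
    exact ⟨x, Set.mem_add.2 ⟨x, rfl, u - x, hx, add_sub_cancel x u⟩⟩
  have hJ : J c A u ∈ SetOp.resolvent c A u := by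
    rw [J, dif_pos hne]
    exact hne.some_mem
  obtain ⟨a, ha, b, hb, hab⟩ := Set.mem_add.1 (show u ∈ _ + _ from hJ)
  obtain rfl : a = J c A u := ha
  rwa [← eq_sub_of_add_eq' hab]

end Minty

end DFRB

namespace DFRB

open Filter

/-! ### Weak convergence along filters and Opial's lemma -/

section Weak

variable {E : Type*} [NormedAddCommGroup E] [InnerProductSpace ℝ E]

/-- Weak convergence in a Hilbert space along a filter. -/
def WeakTendsto {α : Type*} (u : α → E) (l : Filter α) (a : E) : Prop :=
  ∀ w, Tendsto (fun k => inner ℝ w (u k)) l (𝓝 (inner ℝ w a))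

theorem WeakTendsto.weaklyConvergesTo [CompleteSpace E] {u : ℕ → E} {a : E}
    (h : WeakTendsto u atTop a) : WeaklyConvergesTo u a := by
  have hind : Topology.IsInducing
      fun (v : WeakSpace ℝ E) (φ : StrongDual ℝ E) => (topDualPairing ℝ E).flip v φ := ⟨rfl⟩
  refine hind.tendsto_nhds_iff.2 (tendsto_pi_nhds.2 fun φ => ?_)
  have := h ((InnerProductSpace.toDual ℝ E).symm φ)
  simp only [InnerProductSpace.toDual_symm_apply] at this
  exact this

/-- Banach–Alaoglu in the dual, carried back by the Riesz isometry. Ultrafilters take the place of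
weakly convergent subsequences. -/
theorem exists_weakTendsto_of_bounded [CompleteSpace E] {α : Type*} (U : Ultrafilter α) {u : α → E}
    {R : ℝ} (hR : ∀ k, ‖u k‖ ≤ R) : ∃ a, WeakTendsto u U a := by
  have hc := WeakDual.isCompact_closedBall (𝕜 := ℝ) (E := E) 0 R
  obtain ⟨φ, -, hφ⟩ := hc.ultrafilter_le_nhds
    (U.map fun k => StrongDual.toWeakDual (InnerProductSpace.toDual ℝ E (u k))) 
      (le_principal_iff.2 (Ultrafilter.mem_map.2 (univ_mem' fun k => by simp [hR k])))
  refine ⟨(InnerProductSpace.toDual ℝ E).symm (WeakDual.toStrongDual φ), fun w => ?_⟩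
  have := tendsto_iff_forall_eval_tendsto_topDualPairing.1
    (show Tendsto (fun k => StrongDual.toWeakDual (InnerProductSpace.toDual ℝ E (u k))) U (𝓝 φ)
      from hφ) w
  rw [real_inner_comm, InnerProductSpace.toDual_symm_apply]
  refine Tendsto.congr (fun k => ?_) this
  rw [real_inner_comm]
  exact InnerProductSpace.toDual_apply_apply

theorem WeakTendsto.of_ultrafilter {α : Type*} {l : Filter α} {u : α → E} {a : E}
    (h : ∀ U : Ultrafilter α, ↑U ≤ l → WeakTendsto u U a) : WeakTendsto u l a := fun w =>
  tendsto_iff_ultrafilter _ _ _ |>.2 fun U hU => h U hU w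

/-- Opial's lemma. -/
theorem exists_weakTendsto_of_fejer [CompleteSpace E] {S : Set E} (hS : S.Nonempty) {u : ℕ → E}
    (hfejer : ∀ s ∈ S, ∀ k, ‖u (k + 1) - s‖ ≤ ‖u k - s‖)
    (hcluster : ∀ (U : Ultrafilter ℕ) (a : E), ↑U ≤ (atTop : Filter ℕ) → WeakTendsto u U a → a ∈ S) :
    ∃ a ∈ S, WeakTendsto u atTop a := by
  obtain ⟨s, hs⟩ := hS
  have hanti : ∀ s ∈ S, Antitone fun k => ‖u k - s‖ := fun s hs =>
    antitone_nat_of_succ_le (hfejer s hs)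
  have hR : ∀ k, ‖u k‖ ≤ ‖u 0 - s‖ + ‖s‖ := fun k => by
    have h1 := hanti s hs (Nat.zero_le k)
    have h2 := norm_add_le (u k - s) s
    rw [sub_add_cancel] at h2
    simp only at h1
    linarith
  have hlim : ∀ s ∈ S, ∃ r, Tendsto (fun k => ‖u k - s‖) atTop (𝓝 r) := fun s hs =>
    ⟨_, tendsto_atTop_ciInf (hanti s hs) ⟨0, by rintro _ ⟨k, rfl⟩; positivity⟩⟩
  have hex : ∀ U : Ultrafilter ℕ, ↑U ≤ (atTop : Filter ℕ) → ∃ a ∈ S, WeakTendsto u U a := by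
    intro U hU
    obtain ⟨a, ha⟩ := exists_weakTendsto_of_bounded U hR
    exact ⟨a, hcluster U a hU ha, ha⟩
  obtain ⟨a, haS, ha⟩ := hex (hyperfilter ℕ) Nat.hyperfilter_le_atTop
  refine ⟨a, haS, WeakTendsto.of_ultrafilter fun V hV => ?_⟩
  obtain ⟨b, hbS, hb⟩ := hex V hV
  obtain ⟨r, hr⟩ := hlim a haS
  obtain ⟨t, ht⟩ := hlim b hbS
  -- The difference of the squared distances to `b` and to `a` is affine in `u k`. Its limit exists
  -- along `atTop`, so both ultrafilters see the same value of `⟪a - b, ·⟫`.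
  have hdiff : Tendsto (fun k => inner ℝ (a - b) (u k)) atTop
      (𝓝 ((t ^ 2 - r ^ 2 + ‖a‖ ^ 2 - ‖b‖ ^ 2) / 2)) := by
    refine (((((ht.pow 2).sub (hr.pow 2)).add_const (‖a‖ ^ 2)).sub_const (‖b‖ ^ 2)).div_const
      2).congr fun k => ?_
    rw [norm_sub_sq_real, norm_sub_sq_real, inner_sub_left, real_inner_comm a, real_inner_comm b]
    ring
  have h1 := tendsto_nhds_unique (hdiff.mono_left Nat.hyperfilter_le_atTop) (ha (a - b))
  have h2 := tendsto_nhds_unique (hdiff.mono_left hV) (hb (a - b))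
  have h3 : inner ℝ (a - b) (a - b) = 0 := by
    rw [inner_sub_right, ← h1, ← h2, sub_self]
  rwa [sub_eq_zero.1 (inner_self_eq_zero.1 h3)]

theorem WeakTendsto.add {α : Type*} {l : Filter α} {u v : α → E} {a b : E}
    (hu : WeakTendsto u l a) (hv : WeakTendsto v l b) :
    WeakTendsto (fun k => u k + v k) l (a + b) := fun w => by
  simp only [inner_add_right]
  exact (hu w).add (hv w)

theorem WeakTendsto.sub {α : Type*} {l : Filter α} {u v : α → E} {a b : E}
    (hu : WeakTendsto u l a) (hv : WeakTendsto v l b) :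
    WeakTendsto (fun k => u k - v k) l (a - b) := fun w => by
  simp only [inner_sub_right]
  exact (hu w).sub (hv w)

theorem weakTendsto_of_tendsto {α : Type*} {l : Filter α} {u : α → E} {a : E}
    (hu : Tendsto u l (𝓝 a)) : WeakTendsto u l a := fun _ => tendsto_const_nhds.inner hu

theorem WeakTendsto.apply {m : ℕ} {α : Type*} {l : Filter α} {u : α → Pow E m} {a : Pow E m}
    (hu : WeakTendsto u l a) (i : Fin m) : WeakTendsto (fun k => u k i) l (a i) := fun w => by
  have := hu (PiLp.single 2 i w)
  have hsingle : ∀ v : Pow E m, inner ℝ (PiLp.single 2 i w) v = inner ℝ w (v i) := fun v => by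
    rw [PiLp.inner_apply, Finset.sum_eq_single i] <;> simp +contextual
  simpa only [hsingle] using this

theorem weakTendsto_pi {m : ℕ} {α : Type*} {l : Filter α} {u : α → Pow E m} {a : Pow E m}
    (hu : ∀ i, WeakTendsto (fun k => u k i) l (a i)) : WeakTendsto u l a := fun w => by
  simp only [PiLp.inner_apply]
  exact tendsto_finsetSum _ fun i _ => hu i (w i)

end Weak

end DFRB

namespace DFRB

open Filter Finset

/-! ### One iteration as a system of monotone inclusions: Fejér estimate and demiclosedness -/

section Splitting

variable {H : Type*} [NormedAddCommGroup H] [InnerProductSpace ℝ H]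

/-- The reflected terms of the method. -/
def forwardGap (b : ℕ → H → H) (x : ℕ → H) (i : ℕ) : H := b i (x i) - b i (x (i - 1))

/-- The element of the `i`-th forward-perturbed operator that is selected by one iteration; the
vectors `z` have entries `0, …, N - 1`, continued by `z N = 0`. -/
def stepVec (N : ℕ) (b : ℕ → H → H) (z x : ℕ → H) : ℕ → H
  | 0 => z 0 - x 0
  | i + 1 => z (i + 1) - z i + (forwardGap b x (i + 1) - forwardGap b x i) + (x i - x (i + 1))
      + if i + 1 = N then x 0 else 0

/-- `x` solves the inclusions defining one iteration at `z`. -/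
def IsStep (N : ℕ) (M : ℕ → SetOp H) (b : ℕ → H → H) (z x : ℕ → H) : Prop :=
  ∀ i ≤ N, stepVec N b z x i - b i (x i) ∈ M i (x i)

/-- The assumptions on the operators in the splitting method. -/
structure IsAdmissible (N : ℕ) (M : ℕ → SetOp H) (b : ℕ → H → H) (l : ℝ) : Prop where
  one_le : 1 ≤ N
  mono : ∀ i, (M i).IsMonotone
  surj : ∀ i u, ∃ x, u - x ∈ M i x
  forward_mono : ∀ i v w, 0 ≤ inner ℝ (v - w) (b i v - b i w)
  forward_lip : ∀ i v w, ‖b i v - b i w‖ ≤ l * ‖v - w‖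
  forward_last : ∀ v, b N v = 0
  nonneg : 0 ≤ l
  lt_half : l < 1 / 2

/-- Summation by parts in `ζ` and `f`, and polarization of `⟪u (i + 1), u i - u (i + 1)⟫`. -/
theorem sum_inner_telescope (u ζ f : ℕ → H) (N : ℕ) :
    inner ℝ (u 0) (ζ 0 + f 0 - u 0) + ∑ i ∈ range N, inner ℝ (u (i + 1))
      (ζ (i + 1) - ζ i + (f (i + 1) - f i) + (u i - u (i + 1))) =
    inner ℝ (u N) (ζ N) + inner ℝ (u N) (f N) - ∑ i ∈ range N, inner ℝ (u (i + 1) - u i) (ζ i)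
      - ∑ i ∈ range N, inner ℝ (u (i + 1) - u i) (f i)
      - (‖u 0‖ ^ 2 + ‖u N‖ ^ 2 + ∑ i ∈ range N, ‖u (i + 1) - u i‖ ^ 2) / 2 := by
  induction N with
  | zero =>
    simp [inner_add_right, inner_sub_right]
  | succ N ih =>
    simp only [sum_range_succ, norm_sub_sq_real, inner_add_right, inner_sub_right,
      inner_sub_left, real_inner_self_eq_norm_sq] at ih ⊢
    linarith

omit [InnerProductSpace ℝ H] in
@[simp]
theorem forwardGap_const (b : ℕ → H → H) (p : H) (i : ℕ) : forwardGap b (fun _ => p) i = 0 := by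
  simp [forwardGap]

omit [InnerProductSpace ℝ H] in
@[simp]
theorem forwardGap_zero (b : ℕ → H → H) (x : ℕ → H) : forwardGap b x 0 = 0 := by
  simp [forwardGap]

omit [InnerProductSpace ℝ H] in
theorem sum_stepVec_const {N : ℕ} (hN : 1 ≤ N) (b : ℕ → H → H) (z : ℕ → H) (p : H) :
    ∑ i ∈ range (N + 1), stepVec N b z (fun _ => p) i = z N := by
  obtain ⟨N, rfl⟩ : ∃ k, N = k + 1 := ⟨N - 1, by omega⟩
  simp only [sum_range_succ' _ (N + 1), stepVec, forwardGap_const, sub_self, add_zero,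
    sum_add_distrib, sum_range_sub]
  simp

/-- The term `x 0` in the last step vector supplies the cross term that completes `‖x 0 - p‖² + ‖x N
- p‖²` to `‖x N - x 0‖²`. This is an identity: no inclusion is assumed, so it also serves with `z' =
0`, `p = 0`. -/
theorem sum_inner_stepVec {N : ℕ} (hN : 1 ≤ N) {b : ℕ → H → H} (hb : ∀ v, b N v = 0)
    {z z' x : ℕ → H} (hz : z N = 0) (hz' : z' N = 0) (p : H) :
    ∑ i ∈ range (N + 1),
        inner ℝ (x i - p) (stepVec N b z x i - stepVec N b z' (fun _ => p) i) =
      - ∑ i ∈ range N, inner ℝ (x (i + 1) - x i) (z i - z' i)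
      - ∑ i ∈ range N, inner ℝ (x (i + 1) - x i) (forwardGap b x i)
      - (‖x N - x 0‖ ^ 2 + ∑ i ∈ range N, ‖x (i + 1) - x i‖ ^ 2) / 2 := by
  have h := sum_inner_telescope (fun i => x i - p) (fun i => z i - z' i) (forwardGap b x) N
  have hf : forwardGap b x N = 0 := by simp [forwardGap, hb]
  simp only [hz, hz', hf, sub_self, inner_zero_right, sub_sub_sub_cancel_right, forwardGap_zero,
    add_zero, zero_sub] at h
  have hx : ‖x N - x 0‖ ^ 2 = ‖x N - p‖ ^ 2 - 2 * inner ℝ (x N - p) (x 0 - p) + ‖x 0 - p‖ ^ 2 := by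
    rw [← norm_sub_sq_real, sub_sub_sub_cancel_right]
  have hsplit : ∀ i, inner ℝ (x (i + 1) - p)
      (stepVec N b z x (i + 1) - stepVec N b z' (fun _ => p) (i + 1)) =
      inner ℝ (x (i + 1) - p) (z (i + 1) - z' (i + 1) - (z i - z' i)
        + (forwardGap b x (i + 1) - forwardGap b x i) + (x i - x (i + 1)))
      + if i + 1 = N then inner ℝ (x (i + 1) - p) (x 0 - p) else 0 := by
    intro i
    have : stepVec N b z x (i + 1) - stepVec N b z' (fun _ => p) (i + 1) =
        z (i + 1) - z' (i + 1) - (z i - z' i)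
        + (forwardGap b x (i + 1) - forwardGap b x i) + (x i - x (i + 1))
        + if i + 1 = N then x 0 - p else 0 := by
      simp only [stepVec, forwardGap_const]
      split_ifs <;> abel
    rw [this, inner_add_right]
    split_ifs <;> simp
  have hlast : ∑ i ∈ range N, (if i + 1 = N then inner ℝ (x (i + 1) - p) (x 0 - p) else 0) =
      inner ℝ (x N - p) (x 0 - p) := by
    obtain ⟨N, rfl⟩ : ∃ k, N = k + 1 := ⟨N - 1, by omega⟩
    simp
  rw [sum_range_succ', sum_congr rfl fun i _ => hsplit i, sum_add_distrib, hlast]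
  have h0 : stepVec N b z x 0 - stepVec N b z' (fun _ => p) 0 = z 0 - z' 0 - (x 0 - p) := by
    simp only [stepVec]; abel
  rw [h0]
  linarith

variable {N : ℕ} {M : ℕ → SetOp H} {b : ℕ → H → H} {l : ℝ}

theorem IsAdmissible.inner_nonneg (h : IsAdmissible N M b l) {i : ℕ} {x y c w : H}
    (hx : c - b i x ∈ M i x) (hy : w - b i y ∈ M i y) : 0 ≤ inner ℝ (x - y) (c - w) := by
  have h1 := h.mono i (x, c - b i x) hx (y, w - b i y) hy
  have h2 := h.forward_mono i x y
  rw [show c - w = (c - b i x - (w - b i y)) + (b i x - b i y) by abel, inner_add_right]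
  exact add_nonneg h1 h2

theorem IsAdmissible.norm_forwardGap_le (h : IsAdmissible N M b l) (x : ℕ → H) (i : ℕ) :
    ‖forwardGap b x (i + 1)‖ ≤ l * ‖x (i + 1) - x i‖ := h.forward_lip _ _ _

theorem IsAdmissible.neg_sum_inner_forwardGap_le (h : IsAdmissible N M b l) (x : ℕ → H) (k : ℕ) :
    - ∑ i ∈ range k, inner ℝ (x (i + 1) - x i) (forwardGap b x i) ≤
      l * ∑ i ∈ range k, ‖x (i + 1) - x i‖ ^ 2 := by
  -- Each cross term costs `l / 2` times two neighbouring squares. The last square has so far been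
  -- used only once, and the reserve `l / 2` pays for the next induction step.
  have key : ∀ k, - ∑ i ∈ range (k + 1), inner ℝ (x (i + 1) - x i) (forwardGap b x i) ≤
      l * ∑ i ∈ range (k + 1), ‖x (i + 1) - x i‖ ^ 2 - l / 2 * ‖x (k + 1) - x k‖ ^ 2 := by
    intro k
    induction k with
    | zero =>
      have := mul_nonneg h.nonneg (sq_nonneg ‖x 1 - x 0‖)
      simp
      linarith
    | succ k ih =>
      rw [sum_range_succ, sum_range_succ _ (k + 1)]
      set d := x (k + 1 + 1) - x (k + 1)
      have h1 : -inner ℝ d (forwardGap b x (k + 1)) ≤ ‖d‖ * (l * ‖x (k + 1) - x k‖) :=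
        (neg_le_abs _).trans ((abs_real_inner_le_norm _ _).trans
          (mul_le_mul_of_nonneg_left (h.norm_forwardGap_le x k) (norm_nonneg _)))
      nlinarith [mul_nonneg h.nonneg (sq_nonneg (‖d‖ - ‖x (k + 1) - x k‖))]
  cases k with
  | zero => simp
  | succ k => exact (key k).trans (sub_le_self _ (by have := h.nonneg; positivity))

/-- The Fejér-type estimate. -/
theorem IsAdmissible.two_mul_sum_inner_le (h : IsAdmissible N M b l) {z z' x : ℕ → H} {p : H}
    (hx : IsStep N M b z x) (hp : IsStep N M b z' fun _ => p) (hz : z N = 0) (hz' : z' N = 0) :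
    2 * ∑ i ∈ range N, inner ℝ (x (i + 1) - x i) (z i - z' i) ≤
      -((1 - 2 * l) * ∑ i ∈ range N, ‖x (i + 1) - x i‖ ^ 2) := by
  have h1 := sum_inner_stepVec h.one_le h.forward_last hz hz' (x := x) p
  have h2 : 0 ≤ ∑ i ∈ range (N + 1),
      inner ℝ (x i - p) (stepVec N b z x i - stepVec N b z' (fun _ => p) i) :=
    sum_nonneg fun i hi => h.inner_nonneg (hx i (by simp at hi; omega)) (hp i (by simp at hi; omega))
  have h3 := h.neg_sum_inner_forwardGap_le x N
  nlinarith [sq_nonneg ‖x N - x 0‖]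

/-- The first inclusion does not involve the other components. The estimate bounds the first
component along the iteration and, for `z = z'`, shows that `z` determines `p`. -/
theorem IsAdmissible.norm_first_sub_le (h : IsAdmissible N M b l) {z z' x : ℕ → H} {p : H}
    (hx : IsStep N M b z x) (hp : IsStep N M b z' fun _ => p) : ‖x 0 - p‖ ≤ ‖z 0 - z' 0‖ := by
  have h1 := h.inner_nonneg (hx 0 (Nat.zero_le _)) (hp 0 (Nat.zero_le _))
  have h2 : stepVec N b z x 0 - stepVec N b z' (fun _ => p) 0 = z 0 - z' 0 - (x 0 - p) := by
    simp only [stepVec]; abel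
  rw [h2, inner_sub_right, real_inner_self_eq_norm_sq] at h1
  have h3 := real_inner_le_norm (x 0 - p) (z 0 - z' 0)
  by_contra! hlt
  nlinarith [norm_nonneg (z 0 - z' 0)]

/-- The resolvent of `M i + b i` at `u` is a fixed point of `y ↦ R (u - b i y)`, where the resolvent
`R` of `M i` is nonexpansive; this map is a contraction because `l < 1`. -/
theorem IsAdmissible.exists_add_eq [CompleteSpace H] (h : IsAdmissible N M b l) (i : ℕ) (u : H) :
    ∃ y w, y + w = u ∧ w - b i y ∈ M i y := by
  choose R hR using h.surj i
  have hRlip : ∀ v w, ‖R v - R w‖ ≤ ‖v - w‖ := by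
    intro v w
    have h1 := h.mono i (R v, v - R v) (hR v) (R w, w - R w) (hR w)
    simp only at h1
    rw [show v - R v - (w - R w) = (v - w) - (R v - R w) by abel, inner_sub_right,
      real_inner_self_eq_norm_sq] at h1
    have h3 := real_inner_le_norm (R v - R w) (v - w)
    by_contra! hlt
    nlinarith [norm_nonneg (v - w)]
  have hc : ContractingWith l.toNNReal fun y => R (u - b i y) := by
    refine ⟨?_, LipschitzWith.of_dist_le_mul fun y y' => ?_⟩
    · have := h.lt_half
      rw [Real.toNNReal_lt_one]
      linarith
    · rw [dist_eq_norm, dist_eq_norm, Real.coe_toNNReal _ h.nonneg]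
      refine (hRlip _ _).trans ?_
      rw [sub_sub_sub_cancel_left, norm_sub_rev]
      exact h.forward_lip i y y'
  obtain ⟨y, hy, -⟩ := hc.exists_fixedPoint u (edist_ne_top _ _)
  refine ⟨y, u - y, add_sub_cancel _ _, ?_⟩
  have := hR (u - b i y)
  rw [show R (u - b i y) = y from hy] at this
  rwa [sub_right_comm]

theorem tendsto_inner_zero_of_bounded {α : Type*} {F : Filter α} {u v : α → H} {R : ℝ}
    (hu : Tendsto u F (𝓝 0)) (hv : ∀ k, ‖v k‖ ≤ R) :
    Tendsto (fun k => inner ℝ (u k) (v k)) F (𝓝 0) := by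
  have h0 : Tendsto (fun k => ‖u k‖ * R) F (𝓝 0) := by
    simpa using (tendsto_norm_zero.comp hu).mul_const R
  exact squeeze_zero_norm (fun k => (norm_inner_le_norm _ _).trans
    (mul_le_mul_of_nonneg_left (hv k) (norm_nonneg _))) h0

/-- Demiclosedness. -/
theorem IsAdmissible.isStep_of_weakTendsto [CompleteSpace H] (h : IsAdmissible N M b l)
    {α : Type*} {F : Filter α} [F.NeBot] {z x : α → ℕ → H} {a : ℕ → H} {p : H} {R : ℝ}
    (hx : ∀ k, IsStep N M b (z k) (x k)) (hzN : ∀ k, z k N = 0) (hR : ∀ k i, ‖z k i‖ ≤ R)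
    (hd : ∀ i < N, Tendsto (fun k => x k (i + 1) - x k i) F (𝓝 0))
    (hza : ∀ i, WeakTendsto (fun k => z k i) F (a i)) (haN : a N = 0)
    (hxp : WeakTendsto (fun k => x k 0) F p) : IsStep N M b a fun _ => p := by
  have hx0 : ∀ i ≤ N, Tendsto (fun k => x k i - x k 0) F (𝓝 0) := by
    intro i
    induction i with
    | zero => simp
    | succ i ih =>
      intro hi
      simpa using (hd i (by omega)).add (ih (by omega))
  have hxi : ∀ i ≤ N, WeakTendsto (fun k => x k i) F p := fun i hi => by
    simpa using (weakTendsto_of_tendsto (hx0 i hi)).add hxp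
  have hf : ∀ i ≤ N, Tendsto (fun k => forwardGap b (x k) i) F (𝓝 0) := by
    rintro (_ | i) hi
    · simp
    · refine squeeze_zero_norm (fun k => h.norm_forwardGap_le (x k) i) ?_
      simpa using (tendsto_norm_zero.comp (hd i (by omega))).const_mul l
  set c : ℕ → H := stepVec N b a fun _ => p with hc
  have hstep : ∀ i ≤ N, WeakTendsto (fun k => stepVec N b (z k) (x k) i) F (c i) := by
    rintro (_ | i) hi
    · exact (hza 0).sub hxp
    · have h1 := (((hza (i + 1)).sub (hza i)).add
        ((weakTendsto_of_tendsto (hf (i + 1) hi)).sub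
          (weakTendsto_of_tendsto (hf i (by omega))))).add
        ((hxi i (by omega)).sub (hxi (i + 1) hi))
      simp only [hc, stepVec, forwardGap_const]
      split_ifs
      · exact h1.add hxp
      · simpa using h1
  -- Products of two weakly convergent sequences need not converge; here the summation identity
  -- rewrites their sum so that every term contains a difference of `x` tending strongly to `0`.
  have hsum0 : Tendsto (fun k => ∑ i ∈ range (N + 1),
      inner ℝ (x k i) (stepVec N b (z k) (x k) i)) F (𝓝 0) := by
    have hzero : ∀ i, stepVec N b (fun _ => 0) (fun _ => (0 : H)) i = 0 := by
      rintro (_ | i) <;> simp [stepVec]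
    have heq := fun k => sum_inner_stepVec h.one_le h.forward_last (hzN k)
      (z' := fun _ => 0) rfl (x := x k) 0
    simp only [hzero, sub_zero] at heq
    simp only [heq]
    have t1 : Tendsto (fun k => ∑ i ∈ range N, inner ℝ (x k (i + 1) - x k i) (z k i)) F
        (𝓝 (∑ i ∈ range N, 0)) := tendsto_finsetSum _ fun i hi =>
      tendsto_inner_zero_of_bounded (hd i (mem_range.1 hi)) fun k => hR k i
    have t2 : Tendsto (fun k => ∑ i ∈ range N,
        inner ℝ (x k (i + 1) - x k i) (forwardGap b (x k) i)) F (𝓝 (∑ i ∈ range N, 0)) :=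
      tendsto_finsetSum _ fun i hi => by
        simpa using (hd i (mem_range.1 hi)).inner (𝕜 := ℝ) (hf i (mem_range.1 hi).le)
    have t3 : Tendsto (fun k => ∑ i ∈ range N, ‖x k (i + 1) - x k i‖ ^ 2) F
        (𝓝 (∑ i ∈ range N, 0)) := tendsto_finsetSum _ fun i hi => by
      simpa using (hd i (mem_range.1 hi)).norm.pow 2
    have t4 : Tendsto (fun k => ‖x k N - x k 0‖ ^ 2) F (𝓝 0) := by
      simpa using (hx0 N le_rfl).norm.pow 2
    simpa using (t1.neg.sub t2).sub ((t4.add t3).div_const 2)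
  -- Testing monotonicity at the resolvent point `y i` of `p + c i` makes `c i - w i = y i - p`.
  -- Since the `c i` sum to `0`, the limit inequality becomes `0 ≤ -∑ ‖p - y i‖²`, so `y i = p` and
  -- `w i = c i`.
  choose y w hyw hw using fun i => h.exists_add_eq i (p + c i)
  have hlim : Tendsto (fun k => ∑ i ∈ range (N + 1),
      inner ℝ (x k i - y i) (stepVec N b (z k) (x k) i - w i)) F
      (𝓝 (0 - ∑ i ∈ range (N + 1), (inner ℝ p (w i) + inner ℝ (y i) (c i - w i)))) := by
    have t1 : Tendsto (fun k => ∑ i ∈ range (N + 1), (inner ℝ (x k i) (w i)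
        + inner ℝ (y i) (stepVec N b (z k) (x k) i - w i))) F
        (𝓝 (∑ i ∈ range (N + 1), (inner ℝ p (w i) + inner ℝ (y i) (c i - w i)))) := by
      refine tendsto_finsetSum _ fun i hi => ?_
      have hi : i ≤ N := Nat.lt_succ_iff.1 (mem_range.1 hi)
      refine Tendsto.add ?_ ?_
      · simpa only [real_inner_comm] using hxi i hi (w i)
      · simpa only [inner_sub_right] using (hstep i hi (y i)).sub_const (inner ℝ (y i) (w i))
    refine (hsum0.sub t1).congr fun k => ?_
    rw [← sum_sub_distrib]
    refine sum_congr rfl fun i _ => ?_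
    simp only [inner_sub_left, inner_sub_right]
    ring
  have hnonneg := ge_of_tendsto' hlim fun k => sum_nonneg fun i hi =>
    h.inner_nonneg (hx k i (Nat.lt_succ_iff.1 (mem_range.1 hi))) (hw i)
  have hcsum : ∑ i ∈ range (N + 1), inner ℝ p (c i) = 0 := by
    rw [← inner_sum, hc, sum_stepVec_const h.one_le, haN, inner_zero_right]
  have hsq : ∑ i ∈ range (N + 1), ‖p - y i‖ ^ 2 ≤ 0 := by
    have : ∀ i, ‖p - y i‖ ^ 2 = inner ℝ p (w i) + inner ℝ (y i) (c i - w i) - inner ℝ p (c i) := by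
      intro i
      have hwi : w i = p + c i - y i := eq_sub_of_add_eq' (hyw i)
      rw [hwi, ← real_inner_self_eq_norm_sq]
      simp only [inner_sub_left, inner_sub_right, inner_add_right]
      rw [real_inner_comm p (y i)]
      ring
    rw [sum_congr rfl fun i _ => this i, sum_sub_distrib, hcsum]
    linarith
  intro i hi
  have hi0 := (sum_eq_zero_iff_of_nonneg fun i _ => sq_nonneg ‖p - y i‖).1
    (le_antisymm hsq (sum_nonneg fun i _ => sq_nonneg _)) i (mem_range.2 (Nat.lt_succ_of_le hi))
  have hpy : p = y i := sub_eq_zero.1 (norm_eq_zero.1 ((pow_eq_zero_iff two_ne_zero).1 hi0))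
  have hwc : w i = c i := by
    have := hyw i
    rw [← hpy] at this
    exact add_left_cancel this
  have := hw i
  rwa [hwc, ← hpy] at this

end Splitting

end DFRB

namespace DFRB

open Filter Finset

/-! ### Translation between the method on product spaces and the abstract inclusions -/

section Assembly

variable {H : Type*} [NormedAddCommGroup H] [InnerProductSpace ℝ H] {n : ℕ}

/-- Scaled operators indexed by `ℕ`; the last one is repeated. -/
def opExt (hn : 3 ≤ n) (A : Fin n → SetOp H) (lam : ℝ) (i : ℕ) : SetOp H :=
  lam • A ⟨min i (n - 1), by omega⟩

/-- Scaled forward operators, shifted by one and continued by zero. -/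
def forwardExt (B : Fin (n - 2) → H → H) (lam : ℝ) : ℕ → H → H
  | 0 => fun _ => 0
  | i + 1 => fun v => if h : i < n - 2 then lam • B ⟨i, h⟩ v else 0

/-- Vectors continued by zero. -/
def vecExt {k : ℕ} (v : Pow H k) (i : ℕ) : H := if h : i < k then v ⟨i, h⟩ else 0

theorem opExt_of_lt (hn : 3 ≤ n) (A : Fin n → SetOp H) (lam : ℝ) {i : ℕ} (hi : i < n) :
    opExt hn A lam i = lam • A ⟨i, hi⟩ := by
  have : min i (n - 1) = i := by omega
  simp only [opExt, this]

theorem forwardExt_succ (B : Fin (n - 2) → H → H) (lam : ℝ) {i : ℕ} (hi : i < n - 2) (v : H) :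
    forwardExt B lam (i + 1) v = lam • B ⟨i, hi⟩ v := dif_pos hi

omit [InnerProductSpace ℝ H] in
theorem vecExt_of_lt {k : ℕ} (v : Pow H k) {i : ℕ} (hi : i < k) : vecExt v i = v ⟨i, hi⟩ :=
  dif_pos hi

omit [InnerProductSpace ℝ H] in
@[simp]
theorem vecExt_self {k : ℕ} (v : Pow H k) : vecExt v k = 0 := dif_neg (lt_irrefl k)

omit [InnerProductSpace ℝ H] in
theorem norm_vecExt_le {k : ℕ} (v : Pow H k) (i : ℕ) : ‖vecExt v i‖ ≤ ‖v‖ := by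
  unfold vecExt
  split_ifs with h
  · exact PiLp.norm_apply_le v ⟨i, h⟩
  · simp

theorem WeakTendsto.vecExt {k : ℕ} {α : Type*} {F : Filter α} {u : α → Pow H k} {a : Pow H k}
    (hu : WeakTendsto u F a) (i : ℕ) :
    WeakTendsto (fun j => DFRB.vecExt (u j) i) F (DFRB.vecExt a i) := by
  unfold DFRB.vecExt
  split_ifs with h
  · exact hu.apply ⟨i, h⟩
  · exact fun w => tendsto_const_nhds

theorem sum_forwardExt (hn : 3 ≤ n) (B : Fin (n - 2) → H → H) (lam : ℝ) (v : H) :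
    ∑ i ∈ range n, forwardExt B lam i v = lam • ∑ j, B j v := by
  have h1 : ∑ i ∈ range (n - 2 + 1 + 1), forwardExt B lam i v = lam • ∑ j, B j v := by
    rw [sum_range_succ, sum_range_succ', ← Fin.sum_univ_eq_sum_range
      (fun i => forwardExt B lam (i + 1) v), smul_sum]
    simp [forwardExt]
  rwa [show n - 2 + 1 + 1 = n by omega] at h1

theorem isAdmissible [CompleteSpace H] (hn : 3 ≤ n) {A : Fin n → SetOp H}
    (hA : ∀ i, (A i).IsMaximallyMonotone) {L : ℝ≥0} {B : Fin (n - 2) → H → H}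
    (hBmono : ∀ i, (SetOp.ofMap (B i)).IsMonotone) (hBlip : ∀ i, LipschitzWith L (B i)) {lam : ℝ}
    (hlam : 0 < lam) (hlam' : lam * L < 1 / 2) :
    IsAdmissible (n - 1) (opExt hn A lam) (forwardExt B lam) (lam * L) where
  one_le := by omega
  mono i := (hA _).1.smul hlam.le
  surj i u := (hA _).exists_sub_mem_smul hlam u
  forward_mono i v w := by
    rcases i with _ | i
    · simp [forwardExt]
    · simp only [forwardExt]
      split_ifs with h
      · rw [← smul_sub, inner_smul_right]
        exact mul_nonneg hlam.le (hBmono ⟨i, h⟩ (v, B ⟨i, h⟩ v) rfl (w, B ⟨i, h⟩ w) rfl)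
      · simp
  forward_lip i v w := by
    have h0 : 0 ≤ lam * L * ‖v - w‖ := by positivity
    rcases i with _ | i
    · simpa [forwardExt] using h0
    · simp only [forwardExt]
      split_ifs with h
      · rw [← smul_sub, norm_smul, Real.norm_of_nonneg hlam.le, mul_assoc]
        exact mul_le_mul_of_nonneg_left ((hBlip ⟨i, h⟩).norm_sub_le v w) hlam.le
      · simpa using h0
  forward_last v := by
    obtain ⟨k, rfl⟩ : ∃ k, n = k + 3 := ⟨n - 3, by omega⟩
    exact dif_neg (lt_irrefl _)
  nonneg := by positivity
  lt_half := hlam'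

/-- The resolvent argument minus `x i` equals `c i - b i (x i)`, because the gap `f i` trades `b i
(x (i - 1))` for `b i (x i)`. -/
theorem isStep_xVec [CompleteSpace H] (hn : 3 ≤ n) {A : Fin n → SetOp H}
    (hA : ∀ i, (A i).IsMaximallyMonotone) (B : Fin (n - 2) → H → H) {lam : ℝ}
    (hlam : 0 < lam) (z : Pow H (n - 1)) :
    IsStep (n - 1) (opExt hn A lam) (forwardExt B lam) (vecExt z) (vecExt (xVec hn A B lam z)) := by
  intro i hi
  have hin : i < n := by omega
  obtain ⟨x, hx⟩ : ∃ x, x = xVec hn A B lam z := ⟨_, rfl⟩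
  rw [← hx]
  have key : ∀ u, x ⟨i, hin⟩ = J lam (A ⟨i, hin⟩) u →
      u - x ⟨i, hin⟩ ∈ (lam • A ⟨i, hin⟩) (x ⟨i, hin⟩) := fun u hu => by
    rw [hu]
    exact (hA _).sub_J_mem hlam u
  rw [opExt_of_lt hn A lam hin, vecExt_of_lt x hin]
  rcases i with _ | _ | i
  · have := key _ (by rw [hx]; exact xVec_first hn A B lam z)
    convert this using 1
    simp only [stepVec, forwardExt, sub_zero, vecExt_of_lt x hin,
      vecExt_of_lt z (show 0 < n - 1 by omega)]
  · have := key _ (xVec_second hn A B lam z x hx)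
    convert this using 1
    have h1 : ¬ (0 + 1 = n - 1) := by omega
    simp only [stepVec, forwardGap, if_neg h1, zero_add, Nat.sub_self, vecExt_of_lt x hin,
      vecExt_of_lt z (show 0 < n - 1 by omega), vecExt_of_lt z (show 1 < n - 1 by omega),
      vecExt_of_lt x (show 0 < n by omega), forwardExt,
      dif_pos (show 0 < n - 2 by omega)]
    abel
  · simp only [stepVec, forwardGap, Nat.add_sub_cancel,
      forwardExt_succ B lam (show i < n - 2 by omega),
      vecExt_of_lt z (show i + 1 < n - 1 by omega),
      vecExt_of_lt x (show 0 < n by omega), vecExt_of_lt x (show i < n by omega),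
      vecExt_of_lt x (show i + 1 < n by omega), vecExt_of_lt x hin]
    by_cases h : i + 3 < n
    · have := key _ (xVec_middle hn A B lam z x hx i h)
      convert this using 1
      have h1 : ¬ (i + 1 + 1 = n - 1) := by omega
      simp only [if_neg h1, forwardExt_succ B lam (show i + 1 < n - 2 by omega),
        vecExt_of_lt z (show i + 1 + 1 < n - 1 by omega), smul_sub]
      abel
    · obtain rfl : n = i + 3 := by omega
      have := key _ (xVec_last hn A B lam z x hx)
      convert this using 1
      have h2 : ∀ v, forwardExt B lam (i + 1 + 1) v = 0 := fun v => dif_neg (by omega)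
      have h3 : vecExt z (i + 1 + 1) = 0 := dif_neg (by omega)
      simp only [h2, h3, Nat.add_one_sub_one, if_true, smul_sub, Nat.reduceSubDiff]
      abel

omit [InnerProductSpace ℝ H] in
theorem mem_zer_iff {A : Fin n → SetOp H} {B : Fin (n - 2) → H → H} {p : H} :
    p ∈ SetOp.zer (∑ i, A i + ∑ i, SetOp.ofMap (B i)) ↔
      ∃ a : Fin n → H, (∀ i, a i ∈ A i p) ∧ ∑ i, a i + ∑ j, B j p = 0 := by
  have h1 : (∑ i, A i + ∑ i, SetOp.ofMap (B i)) p = ∑ i, A i p + {∑ j, B j p} := by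
    rw [Pi.add_apply, Finset.sum_apply, Finset.sum_apply]
    congr 1
    exact Set.finsetSum_singleton univ fun j => B j p
  change (0 : H) ∈ (∑ i, A i + ∑ i, SetOp.ofMap (B i)) p ↔ _
  rw [h1, Set.mem_add]
  constructor
  · rintro ⟨s, hs, t, rfl, hst⟩
    obtain ⟨a, ha, rfl⟩ := (Set.mem_fintype_sum _ _).1 hs
    exact ⟨a, ha, hst⟩
  · rintro ⟨a, ha, hsum⟩
    exact ⟨_, (Set.mem_fintype_sum _ _).2 ⟨a, ha, rfl⟩, _, rfl, hsum⟩

theorem mem_zer_of_isStep (hn : 3 ≤ n) {A : Fin n → SetOp H} {B : Fin (n - 2) → H → H} {lam : ℝ}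
    (hlam : lam ≠ 0) {z : ℕ → H} {p : H} (hz : z (n - 1) = 0)
    (h : IsStep (n - 1) (opExt hn A lam) (forwardExt B lam) z fun _ => p) :
    p ∈ SetOp.zer (∑ i, A i + ∑ i, SetOp.ofMap (B i)) := by
  set c := stepVec (n - 1) (forwardExt B lam) z fun _ => p with hc
  refine mem_zer_iff.2 ⟨fun i => lam⁻¹ • (c i - forwardExt B lam i p), fun i => ?_, ?_⟩
  · have := h i (by omega)
    rwa [opExt_of_lt hn A lam i.2, SetOp.mem_smul_iff hlam] at this
  · rw [Fin.sum_univ_eq_sum_range fun i => lam⁻¹ • (c i - forwardExt B lam i p), ← smul_sum,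
      sum_sub_distrib, sum_forwardExt hn]
    have := sum_stepVec_const (show 1 ≤ n - 1 by omega) (forwardExt B lam) z p
    rw [hz, Nat.sub_add_cancel (by omega)] at this
    rw [hc, this, zero_sub, smul_neg, smul_smul, inv_mul_cancel₀ hlam, one_smul, neg_add_cancel]

theorem exists_isStep_of_mem_zer (hn : 3 ≤ n) {A : Fin n → SetOp H} {B : Fin (n - 2) → H → H}
    {lam : ℝ} {p : H} (hp : p ∈ SetOp.zer (∑ i, A i + ∑ i, SetOp.ofMap (B i))) :
    ∃ z : Pow H (n - 1),
      IsStep (n - 1) (opExt hn A lam) (forwardExt B lam) (vecExt z) fun _ => p := by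
  obtain ⟨a, ha, hsum⟩ := mem_zer_iff.1 hp
  set g : ℕ → H := fun j => (if h : j < n then lam • a ⟨j, h⟩ else 0) + forwardExt B lam j p with hg
  have hgsum : ∑ j ∈ range n, g j = 0 := by
    rw [hg, sum_add_distrib, sum_forwardExt hn,
      ← Fin.sum_univ_eq_sum_range fun j => if h : j < n then lam • a ⟨j, h⟩ else 0]
    simp only [Fin.is_lt, dif_pos, Fin.eta]
    rw [← smul_sum, ← smul_add, hsum, smul_zero]
  -- Partial sums make the step vectors equal to `g`. In the last step, `p - z (N - 1)` is minus the
  -- sum of all earlier `g j`, which is `g N` since the total vanishes.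
  refine ⟨WithLp.toLp 2 fun i => p + ∑ j ∈ range (i + 1), g j, fun i hi => ?_⟩
  set z : Pow H (n - 1) := WithLp.toLp 2 fun i => p + ∑ j ∈ range (i + 1), g j
  have hz : ∀ i < n - 1, vecExt z i = p + ∑ j ∈ range (i + 1), g j := fun i hi => dif_pos hi
  have hstep : stepVec (n - 1) (forwardExt B lam) (vecExt z) (fun _ => p) i = g i := by
    rcases i with _ | i
    · simp only [stepVec]
      rw [hz 0 (by omega)]
      simp
    · simp only [stepVec, forwardGap_const, sub_self, add_zero]
      rw [hz i (by omega)]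
      split_ifs with h
      · rw [show n = i + 1 + 1 by omega, sum_range_succ] at hgsum
        rw [h, vecExt_self, ← h]
        rw [← eq_neg_of_add_eq_zero_right hgsum |>.symm]
        abel
      · rw [hz (i + 1) (by omega), sum_range_succ _ (i + 1)]
        abel
  rw [hstep, opExt_of_lt hn A lam (show i < n by omega)]
  have : g i - forwardExt B lam i p = lam • a ⟨i, by omega⟩ := by
    simp only [hg]
    rw [dif_pos (show i < n by omega), add_sub_cancel_right]
  rw [this]
  exact Set.smul_mem_smul_set (ha _)

theorem inner_diffVec (x : Pow H n) (v : Pow H (n - 1)) :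
    inner ℝ (diffVec x) v =
      ∑ i ∈ range (n - 1), inner ℝ (vecExt x (i + 1) - vecExt x i) (vecExt v i) := by
  rw [PiLp.inner_apply,
    ← Fin.sum_univ_eq_sum_range fun i => inner ℝ (vecExt x (i + 1) - vecExt x i) (vecExt v i)]
  refine sum_congr rfl fun i _ => ?_
  rw [vecExt_of_lt x (show (i : ℕ) + 1 < n by omega), vecExt_of_lt x (show (i : ℕ) < n by omega),
    vecExt_of_lt v i.2]
  rfl

omit [InnerProductSpace ℝ H] in
theorem vecExt_diffVec (x : Pow H n) {i : ℕ} (hi : i < n - 1) :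
    vecExt (diffVec x) i = vecExt x (i + 1) - vecExt x i := by
  rw [vecExt_of_lt _ hi, vecExt_of_lt x (show i + 1 < n by omega),
    vecExt_of_lt x (show i < n by omega)]
  rfl

omit [InnerProductSpace ℝ H] in
theorem vecExt_sub {k : ℕ} (v w : Pow H k) (i : ℕ) :
    vecExt (v - w) i = vecExt v i - vecExt w i := by
  unfold vecExt
  split_ifs <;> simp

theorem norm_diffVec_sq (x : Pow H n) :
    ‖diffVec x‖ ^ 2 = ∑ i ∈ range (n - 1), ‖vecExt x (i + 1) - vecExt x i‖ ^ 2 := by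
  rw [← real_inner_self_eq_norm_sq, inner_diffVec]
  refine sum_congr rfl fun i hi => ?_
  rw [vecExt_diffVec x (mem_range.1 hi), real_inner_self_eq_norm_sq]

theorem IsAdmissible.two_mul_inner_diffVec_le {M : ℕ → SetOp H} {b : ℕ → H → H} {l : ℝ}
    (h : IsAdmissible (n - 1) M b l) {z z' : Pow H (n - 1)} {x : Pow H n} {p : H}
    (hx : IsStep (n - 1) M b (vecExt z) (vecExt x))
    (hp : IsStep (n - 1) M b (vecExt z') fun _ => p) :
    2 * inner ℝ (diffVec x) (z - z') ≤ -((1 - 2 * l) * ‖diffVec x‖ ^ 2) := by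
  rw [inner_diffVec, norm_diffVec_sq]
  simp only [vecExt_sub]
  exact h.two_mul_sum_inner_le hx hp (vecExt_self z) (vecExt_self z')

theorem IsAdmissible.norm_add_smul_sub_sq_le {M : ℕ → SetOp H} {b : ℕ → H → H} {l γ : ℝ}
    (h : IsAdmissible (n - 1) M b l) (hγ : 0 ≤ γ) {z z' : Pow H (n - 1)} {x : Pow H n} {p : H}
    (hx : IsStep (n - 1) M b (vecExt z) (vecExt x))
    (hp : IsStep (n - 1) M b (vecExt z') fun _ => p) :
    ‖z + γ • diffVec x - z'‖ ^ 2 ≤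
      ‖z - z'‖ ^ 2 - γ * (1 - 2 * l - γ) * ‖diffVec x‖ ^ 2 := by
  have h1 := mul_le_mul_of_nonneg_left (h.two_mul_inner_diffVec_le hx hp) hγ
  rw [add_sub_right_comm, norm_add_sq_real, inner_smul_right, norm_smul, mul_pow,
    Real.norm_of_nonneg hγ, real_inner_comm]
  linarith

end Assembly

end DFRB

/-! ### Convergence of the method -/

theorem mainTheorem2 {H : Type*} [NormedAddCommGroup H] [InnerProductSpace ℝ H] [CompleteSpace H]
    (n : ℕ) (hn : 3 ≤ n)
    (A : Fin n → DFRB.SetOp H) (hA : ∀ i, (A i).IsMaximallyMonotone)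
    (L : ℝ≥0) (hL : 0 < L)
    (B : Fin (n - 2) → H → H)
    (hBmono : ∀ i, (DFRB.SetOp.ofMap (B i)).IsMonotone)
    (hBlip : ∀ i, LipschitzWith L (B i))
    (hzer : (DFRB.SetOp.zer (∑ i, A i + ∑ i, DFRB.SetOp.ofMap (B i))).Nonempty)
    (lam : ℝ) (hlam : lam ∈ Set.Ioo (0 : ℝ) (1 / (2 * (L : ℝ))))
    (γ : ℝ) (hγ : γ ∈ Set.Ioo (0 : ℝ) (1 - 2 * lam * (L : ℝ)))
    (z₀ : DFRB.Pow H (n - 1))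
    (z : ℕ → DFRB.Pow H (n - 1)) (x : ℕ → DFRB.Pow H n)
    (hz₀ : z 0 = z₀)
    (hz : ∀ k, z (k + 1) = z k + γ • DFRB.diffVec (x k))
    (hx : ∀ k, x k = DFRB.xVec hn A B lam (z k)) :
    (∃ zlim : DFRB.Pow H (n - 1),
      Function.IsFixedPt (DFRB.TTilde hn A B lam γ) zlim ∧ DFRB.WeaklyConvergesTo z zlim) ∧
    (∃ xlim : H,
      xlim ∈ DFRB.SetOp.zer (∑ i, A i + ∑ i, DFRB.SetOp.ofMap (B i)) ∧
      DFRB.WeaklyConvergesTo x (WithLp.toLp 2 (fun _ : Fin n => xlim))) := by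
  open DFRB Filter in
  obtain ⟨hlam0, hlam1⟩ := hlam
  obtain ⟨hγ0, hγ1⟩ := hγ
  have hLpos : (0 : ℝ) < L := by exact_mod_cast hL
  have hlamL : lam * L < 1 / 2 := by
    rw [lt_div_iff₀ (by positivity)] at hlam1
    linarith
  have hadm := isAdmissible hn hA hBmono hBlip hlam0 hlamL
  set M := opExt hn A lam
  set b := forwardExt B lam
  have hstep : ∀ k, IsStep (n - 1) M b (vecExt (z k)) (vecExt (x k)) := fun k => by
    rw [hx k]
    exact isStep_xVec hn hA B hlam0 (z k)
  set S : Set (DFRB.Pow H (n - 1)) := {s | ∃ p, IsStep (n - 1) M b (vecExt s) fun _ => p}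
  obtain ⟨p₀, hp₀⟩ := hzer
  obtain ⟨s₀, hs₀⟩ := exists_isStep_of_mem_zer hn (lam := lam) hp₀
  set c := γ * (1 - 2 * (lam * L) - γ)
  have hcpos : 0 < c := mul_pos hγ0 (by linarith)
  have hdec : ∀ s ∈ S, ∀ k,
      ‖z (k + 1) - s‖ ^ 2 ≤ ‖z k - s‖ ^ 2 - c * ‖diffVec (x k)‖ ^ 2 := by
    rintro s ⟨p, hp⟩ k
    rw [hz k]
    exact hadm.norm_add_smul_sub_sq_le hγ0.le (hstep k) hp
  have hfejer : ∀ s ∈ S, ∀ k, ‖z (k + 1) - s‖ ≤ ‖z k - s‖ := fun s hs k =>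
    le_of_sq_le_sq ((hdec s hs k).trans (sub_le_self _ (by positivity))) (norm_nonneg _)
  have hanti : Antitone fun k => ‖z k - s₀‖ := antitone_nat_of_succ_le (hfejer s₀ ⟨p₀, hs₀⟩)
  have hzbdd : ∀ k, ‖z k - s₀‖ ≤ ‖z 0 - s₀‖ := fun k => hanti (Nat.zero_le k)
  -- The squared distances to `s₀` converge, so their consecutive differences, which dominate `c *
  -- ‖diffVec (x k)‖ ^ 2`, tend to `0`.
  have hdiff : Tendsto (fun k => ‖diffVec (x k)‖) atTop (𝓝 0) := by
    have h1 := (tendsto_atTop_ciInf hanti ⟨0, by rintro _ ⟨k, rfl⟩; positivity⟩).pow 2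
    have h2 := (h1.sub ((tendsto_add_atTop_iff_nat 1).2 h1)).div_const c
    rw [sub_self, zero_div] at h2
    have h3 : Tendsto (fun k => ‖diffVec (x k)‖ ^ 2) atTop (𝓝 0) :=
      squeeze_zero (fun k => sq_nonneg _) (fun k => by
        rw [le_div_iff₀ hcpos]
        linarith [hdec s₀ ⟨p₀, hs₀⟩ k]) h2
    simpa using h3.sqrt
  have hd : ∀ i < n - 1,
      Tendsto (fun k => vecExt (x k) (i + 1) - vecExt (x k) i) atTop (𝓝 0) := fun i hi =>
    squeeze_zero_norm (fun k => by
      rw [← vecExt_diffVec (x k) hi]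
      exact norm_vecExt_le _ i) hdiff
  have hznorm : ∀ k i, ‖vecExt (z k) i‖ ≤ ‖z 0 - s₀‖ + ‖s₀‖ := fun k i => by
    have h1 := norm_add_le (z k - s₀) s₀
    rw [sub_add_cancel] at h1
    linarith [norm_vecExt_le (z k) i, hzbdd k]
  have hx0norm : ∀ k, ‖vecExt (x k) 0‖ ≤ ‖z 0 - s₀‖ + ‖p₀‖ := fun k => by
    have h1 := hadm.norm_first_sub_le (hstep k) hs₀
    have h2 := norm_add_le (vecExt (x k) 0 - p₀) p₀
    rw [sub_add_cancel] at h2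
    rw [← vecExt_sub] at h1
    linarith [norm_vecExt_le (z k - s₀) 0, hzbdd k]
  have hcluster : ∀ (U : Ultrafilter ℕ) (a : DFRB.Pow H (n - 1)), ↑U ≤ (atTop : Filter ℕ) →
      WeakTendsto z U a → ∃ q, WeakTendsto (fun k => vecExt (x k) 0) U q ∧
        IsStep (n - 1) M b (vecExt a) fun _ => q := by
    intro U a hU ha
    obtain ⟨q, hq⟩ := exists_weakTendsto_of_bounded U hx0norm
    exact ⟨q, hq, hadm.isStep_of_weakTendsto hstep (fun k => vecExt_self (z k)) hznorm
      (fun i hi => (hd i hi).mono_left hU) (fun i => ha.vecExt i) (vecExt_self a) hq⟩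
  obtain ⟨a, ⟨p, hp⟩, ha⟩ := exists_weakTendsto_of_fejer (S := S) ⟨s₀, p₀, hs₀⟩ hfejer
    fun U a hU ha =>
      let ⟨q, _, hq⟩ := hcluster U a hU ha
      ⟨q, hq⟩
  refine ⟨⟨a, ?_, ha.weaklyConvergesTo⟩,
    ⟨p, mem_zer_of_isStep hn hlam0.ne' (vecExt_self a) hp, ?_⟩⟩
  -- The estimate is applied with both points equal to `a`: its left side vanishes, so the
  -- difference vector at `a` is zero.
  · have h1 := hadm.two_mul_inner_diffVec_le (isStep_xVec hn hA B hlam0 a) hp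
    rw [sub_self, inner_zero_right, mul_zero] at h1
    have h2 : diffVec (xVec hn A B lam a) = 0 := by
      by_contra hne
      have := mul_pos (by linarith : 0 < 1 - 2 * (lam * L)) (pow_pos (norm_pos_iff.2 hne) 2)
      linarith
    rw [Function.IsFixedPt, TTilde, h2, smul_zero, add_zero]
  · have hx0 : WeakTendsto (fun k => vecExt (x k) 0) atTop p := by
      refine WeakTendsto.of_ultrafilter fun U hU => ?_
      -- Any cluster point `q` of the first components solves the constant system for the same `a`
      -- as `p`, hence equals `p`.
      obtain ⟨q, hq, hqs⟩ := hcluster U a hU fun w => (ha w).mono_left hU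
      have := hadm.norm_first_sub_le hqs hp
      rw [sub_self, norm_zero] at this
      rwa [← sub_eq_zero.1 (norm_le_zero_iff.1 this)]
    have hxi : ∀ i < n, WeakTendsto (fun k => vecExt (x k) i) atTop p := by
      intro i
      induction i with
      | zero => exact fun _ => hx0
      | succ i ih =>
        intro hi
        simpa using (weakTendsto_of_tendsto (hd i (by omega))).add (ih (by omega))
    refine (weakTendsto_pi fun i => ?_).weaklyConvergesTo
    simpa only [vecExt_of_lt _ i.2] using hxi i i.2
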